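/- **Setting.** Let $d\ge 2$, let $\mathcal E^d$ and $\vec{\mathcal E}^d$ be the sets of undirected and directed nearest-neighbour edges of $\mathbb Z^d$, and let $\mathbb P$ be a probability measure on $\Omega_1=[0,\infty)^{\mathcal E^d}$ (product Borel $\sigma$-algebra, coordinates $(t_e)$). For a finite lattice path $\gamma$ let $T(\gamma)$ be the sum of the weights along $\gamma$; let $T(x,y)=\inf_{\gamma:x\to y}T(\gamma)$ for $x,y\in\mathbb Z^d$, $T(x,y)=T(\lfloor x\rfloor,\lfloor y\rfloor)$ for $x,y\in\mathbb R^d$ (coordinatewise integer parts), and $T(x,H)=\inf_{z\in H}T(x,z)$ for $H\subset\mathbb R^d$. Let $g(x)=\lim_n T(0,nx)/n$ (limit in probability) and let $\mathcal B=\{x\in\mathbb R^d: g(x)\le 1\}$ be the limit shape. Assume that one of the following holds. * **A.** The $t_e$ are i.i.d. with a continuous (atomless) common distribution, and $\mathbb E\big[(\min_{i\le 2d}t_{e_i})^d\big]<\infty$, where $e_1,\dots,e_{2d}$ are the edges incident to the origin. * **B.** $\mathbb P$ is invariant and ergodic under the translations of $\mathbb Z^d$ and invariant under all symmetries of $\mathbb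 Z^d$; $\mathbb E\,t_e^{d+\epsilon}<\infty$ for some $\epsilon>0$; $\mathcal B$ is bounded; $\mathbb P(T(\gamma)=T(\gamma'))=0$ for all finite paths $\gamma,\gamma'$ with distinct edge sets; and for every edge $e$ and every $\lambda>0$ with $\mathbb P(t_e\ge\lambda)>0$ one has $\mathbb P(t_e\ge\lambda\mid (t_f)_{f\ne e})>0$ a.s. Let $\rho\in\mathbb R^d$ be such that $\{z: z\cdot\rho=1\}$ is a supporting hyperplane of $\mathcal B$ at some point of $\mathcal B$, and put $H_\rho(\alpha)=\{z\in\mathbb R^d:z\cdot\rho=\alpha\}$. A geodesic from $x\in\mathbb Z^d$ to $H_\rho(\alpha)$ is a lattice path from $x$ to $\lfloor z\rfloor$, for some $z\in H_\rho(\alpha)$, with passage time $T(x,H_\rho(\alpha))$. Let $B_\alpha(x,y)=T(x,H_\rho(\alpha))-T(y,H_\rho(\alpha))$, and let $\eta_\alpha(\langle x,y\rangle)=1$ if $\{x,y\}$ is in a geodesic from $x$ to $H_\rho(\alpha)$ and $\eta_\alpha(\langle x,y\rangle)=0$ otherwise. Let $\Omega_2=\mathbb R^{\mathbb Z^d\times\mathbb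 Z^d}$, $\Omega_3=\{0,1\}^{\vec{\mathcal E}^d}$, let $\mu_\alpha$ be the law of $((t_e),B_\alpha,\eta_\alpha)$ on $\Omega_1\times\Omega_2\times\Omega_3$ under $\mathbb P$, let $\mu_n^*=\frac1n\int_0^n\mu_\alpha\,d\alpha$, and let $\mu$ be any subsequential weak limit of $(\mu_n^*)_{n}$. Events in $\Omega_1\times\Omega_3$ are regarded as events of the full space by leaving the $\Omega_2$-coordinate free. A *graph-cylinder event* is a finite union of sets $U\times V$ with $U\subset\Omega_1$ Borel and $V=\{\eta(f_1)=a_1,\dots,\eta(f_m)=a_m\}\subset\Omega_3$ for directed edges $f_i$ and $a_i\in\{0,1\}$. For $e_0\in\mathcal E^d$, a Borel set $A\subset\Omega_1\times\Omega_3$ is *$e_0$-approximable* if there are graph-cylinder events $(A_n)$ with $\mu(A_n\,\Delta\,A)\to 0$ such that for each $n$ there is $\alpha_0$ for which the following holds: whenever $\alpha\ge\alpha_0$ and $(t_e),(t_e')\in\Omega_1$ satisfy $t'_{e_0}\ge t_{e_0}$ and $t'_e=t_e$ for $e\neq e_0$, then $((t_e),\eta_\alpha((t_e)))\in A_n$ implies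 $((t'_e),\eta_\alpha((t'_e)))\in A_n$. **Theorem.** Let $e_0\in\mathcal E^d$ and $\lambda\in[0,S)$, where $S=\sup\{x\ge 0:\mathbb P(t_{e_0}\ge x)>0\}\in[0,\infty]$ is the supremum of the support of the common distribution of the weights. For every $r>0$ there exists $s>0$ such that every $e_0$-approximable event $A$ with $\mu(A)\ge r$ satisfies $$\mu(A,\ t_{e_0}\ge\lambda)\ \ge\ s .$$ -/

import Mathlib

open MeasureTheory ProbabilityTheory Filter Topology
open scoped NNReal ENNReal BoundedContinuousFunction

noncomputable section

namespace FPP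

/-! ### The lattice and its passage times -/

/-- Vertices of `ℤ^d`. -/
abbrev Vertex (d : ℕ) : Type := Fin d → ℤ

/-- The nearest-neighbour graph on `ℤ^d`: vertices at `ℓ¹`-distance one are adjacent. -/
def lattice (d : ℕ) : SimpleGraph (Vertex d) where
  Adj x y := ∑ i, |x i - y i| = 1
  symm := ⟨fun x y h => by simpa only [abs_sub_comm] using h⟩
  loopless := ⟨fun x h => by simp at h⟩

/-- Undirected edges. -/
abbrev Edge (d : ℕ) : Type := (lattice d).edgeSet

/-- Directed edges `⟨x, y⟩`. -/
abbrev DirEdge (d : ℕ) : Type := (lattice d).Dart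

/-- `Ω₁ = [0,∞)^E`: edge-weight configurations `(t_e)`. -/
abbrev Weights (d : ℕ) : Type := Edge d → ℝ≥0

/-- `Ω₂ = ℝ^(ℤ^d × ℤ^d)`: Busemann increments. -/
abbrev Increments (d : ℕ) : Type := Vertex d × Vertex d → ℝ

/-- `Ω₃ = {0,1}^(directed edges)`: graph configurations, `true` standing for `1`. -/
abbrev GraphConfig (d : ℕ) : Type := DirEdge d → Bool

/-- The enlarged space `Ω₁ × Ω₂ × Ω₃`, with the product topology and product `σ`-algebra. -/
abbrev Extended (d : ℕ) : Type := Weights d × Increments d × GraphConfig d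

variable {d : ℕ}

/-- The passage time `T(γ)` of a lattice path: the sum of the weights along it, with multiplicity. -/
def pathTime (t : Weights d) {x y : Vertex d} (p : (lattice d).Walk x y) : ℝ≥0 :=
  (p.darts.map fun a => t ⟨a.edge, a.edge_mem⟩).sum

/-- `T(x,y)` for lattice points: the infimum of `T(γ)` over all lattice paths from `x` to `y`. -/
def vertexTime (t : Weights d) (x y : Vertex d) : ℝ≥0 :=
  ⨅ p : (lattice d).Walk x y, pathTime t p

/-- Coordinatewise integer part of a real point. -/
def floorPt (z : Fin d → ℝ) : Vertex d := fun i => ⌊z i⌋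

/-- `T(x,y) = T(⌊x⌋,⌊y⌋)` for real points. -/
def pointTime (t : Weights d) (x y : Fin d → ℝ) : ℝ≥0 :=
  vertexTime t (floorPt x) (floorPt y)

/-- The hyperplane `H_ρ(α) = {z : z · ρ = α}`. -/
def hyperplane (ρ : Fin d → ℝ) (α : ℝ) : Set (Fin d → ℝ) := {z | z ⬝ᵥ ρ = α}

/-- `T(x, H_ρ(α))`, the infimum over the real points of the hyperplane. -/
def planeTime (t : Weights d) (ρ : Fin d → ℝ) (α : ℝ) (x : Vertex d) : ℝ≥0 :=
  ⨅ z : hyperplane ρ α, vertexTime t x (floorPt z.1)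

/-- `p` is a geodesic from `x` to `H_ρ(α)`: it ends at (the integer part of) a point of the
hyperplane and attains the passage time `T(x, H_ρ(α))`. -/
def IsPlaneGeodesic (t : Weights d) (ρ : Fin d → ℝ) (α : ℝ) {x y : Vertex d}
    (p : (lattice d).Walk x y) : Prop :=
  (∃ z ∈ hyperplane ρ α, floorPt z = y) ∧ pathTime t p = planeTime t ρ α x

/-! ### Assumptions on the law `P` of the weights -/

/-- Assumption A: i.i.d. weights with a continuous common law, such that the `d`-th moment of the
minimum of the weights of the `2d` edges incident to the origin is finite. -/
structure AssumptionA (P : Measure (Weights d)) : Prop where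
  indep : iIndepFun (fun (e : Edge d) (t : Weights d) => t e) P
  identDistrib : ∀ e f : Edge d,
    P.map (fun t : Weights d => t e) = P.map (fun t : Weights d => t f)
  moment : ∫⁻ t : Weights d,
    ((⨅ e : {e : Edge d // (0 : Vertex d) ∈ e.1}, t e.1 : ℝ≥0) : ℝ≥0∞) ^ d ∂P < ∞
  continuous : ∀ (e : Edge d) (a : ℝ≥0), P {t | t e = a} = 0

/-- Action on weights of an automorphism of the lattice, `(t_e) ↦ (t_{φ(e)})`. -/
def moveWeights (φ : lattice d ≃g lattice d) (t : Weights d) : Weights d :=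
  fun e => t (φ.mapEdgeSet e)

/-- The translation `x ↦ x + z` of the lattice. -/
def translation (z : Vertex d) : lattice d ≃g lattice d where
  toEquiv := Equiv.addRight z
  map_rel_iff' := by intro x y; simp [lattice]

/-- `x` has time constant `c = g(x)`: `T(0,nx)/n → c` in probability. -/
def IsTimeConstant (P : Measure (Weights d)) (x : Fin d → ℝ) (c : ℝ) : Prop :=
  TendstoInMeasure P
    (fun (n : ℕ) (t : Weights d) => (pointTime t 0 ((n : ℝ) • x) : ℝ) / n) atTop (fun _ => c)

/-- The limit shape `{x : g(x) ≤ 1}`. -/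
def limitShape (P : Measure (Weights d)) : Set (Fin d → ℝ) :=
  {x | ∃ c : ℝ, IsTimeConstant P x c ∧ c ≤ 1}

/-- The `σ`-algebra generated by the weights `(t_f)_{f ≠ e}`. -/
abbrev sigmaOff (e : Edge d) : MeasurableSpace (Weights d) :=
  MeasurableSpace.comap (fun (t : Weights d) (f : {f : Edge d // f ≠ e}) => t f.1) inferInstance

/-- Assumption B: a translation-ergodic law with all the symmetries of `ℤ^d`, a moment of order
`d + ε`, a bounded limit shape, unique passage times, and upward finite energy. -/
structure AssumptionB (P : Measure (Weights d)) : Prop where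
  stationary : ∀ z : Vertex d, P.map (moveWeights (translation z)) = P
  ergodic : ∀ s : Set (Weights d), MeasurableSet s →
    (∀ z : Vertex d, moveWeights (translation z) ⁻¹' s = s) → P s = 0 ∨ P s = 1
  symmetric : ∀ φ : lattice d ≃g lattice d, P.map (moveWeights φ) = P
  moment : ∃ ε : ℝ, 0 < ε ∧ ∀ e : Edge d, ∫⁻ t : Weights d, (t e : ℝ≥0∞) ^ ((d : ℝ) + ε) ∂P < ∞
  bounded_shape : Bornology.IsBounded (limitShape P)
  unique_times : ∀ (x y x' y' : Vertex d) (p : (lattice d).Walk x y) (q : (lattice d).Walk x' y'),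
    {e | e ∈ p.edges} ≠ {e | e ∈ q.edges} → P {t | pathTime t p = pathTime t q} = 0
  finite_energy : ∀ (e : Edge d) (l : ℝ≥0), 0 < l → 0 < P {t | l ≤ t e} →
    ∀ᵐ t ∂P, 0 < (P⟦{t : Weights d | l ≤ t e} | sigmaOff e⟧) t

/-- `H = {z : z · ρ = 1}` supports the limit shape at some point `z₀` of it (the limit shape
contains the origin, hence lies on the side `z · ρ ≤ 1`). -/
def IsSupporting (P : Measure (Weights d)) (ρ : Fin d → ℝ) : Prop :=
  (∃ z₀ ∈ limitShape P, z₀ ∈ hyperplane ρ 1) ∧ ∀ z ∈ limitShape P, z ⬝ᵥ ρ ≤ 1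

/-- `S`, the supremum of the support of the law of `t_e`, possibly infinite. -/
def supSupport (P : Measure (Weights d)) (e : Edge d) : ℝ≥0∞ :=
  ⨆ (x : ℝ≥0) (_ : 0 < P {t | x ≤ t e}), (x : ℝ≥0∞)

/-! ### Geodesic measures -/

/-- `B_α(x,y) = T(x, H_ρ(α)) - T(y, H_ρ(α))`. -/
def busemann (ρ : Fin d → ℝ) (α : ℝ) (t : Weights d) : Increments d :=
  fun xy => (planeTime t ρ α xy.1 : ℝ) - (planeTime t ρ α xy.2 : ℝ)

open Classical in
/-- `η_α(⟨x,y⟩) = 1` iff the edge `{x,y}` is in a geodesic from `x` to `H_ρ(α)`. -/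
def geoGraph (ρ : Fin d → ℝ) (α : ℝ) (t : Weights d) : GraphConfig d :=
  fun a => decide (∃ (v : Vertex d) (p : (lattice d).Walk a.fst v),
    IsPlaneGeodesic t ρ α p ∧ a.edge ∈ p.edges)

/-- The map `Φ_α : ω ↦ ((t_e), B_α, η_α)`. -/
def Phi (ρ : Fin d → ℝ) (α : ℝ) (t : Weights d) : Extended d :=
  (t, busemann ρ α t, geoGraph ρ α t)

/-- `μ_α`, the image of `P` under `Φ_α`. -/
def planeMeasure (P : Measure (Weights d)) (ρ : Fin d → ℝ) (α : ℝ) : Measure (Extended d) :=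
  P.map (Phi ρ α)

/-- `μ_n^* = (1/n) ∫_0^n μ_α dα`. -/
def averageMeasure (P : Measure (Weights d)) (ρ : Fin d → ℝ) (n : ℕ) : Measure (Extended d) :=
  (n : ℝ≥0∞)⁻¹ • (volume.restrict (Set.Icc (0 : ℝ) n)).bind (planeMeasure P ρ)

/-- `μ` is a probability measure that is a subsequential weak limit of `(μ_n^*)`. -/
structure IsGeodesicMeasure (P : Measure (Weights d)) (ρ : Fin d → ℝ)
    (μ : Measure (Extended d)) : Prop where
  isProb : IsProbabilityMeasure μ
  limit : ∃ n : ℕ → ℕ, StrictMono n ∧ ∀ f : Extended d →ᵇ ℝ,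
    Tendsto (fun k => ∫ ω, f ω ∂(averageMeasure P ρ (n k))) atTop (𝓝 (∫ ω, f ω ∂μ))

/-! ### Approximable events -/

/-- An event of `Ω₁ × Ω₃`, viewed on the full space by leaving the `Ω₂`-coordinate free. -/
def liftEvent (A : Set (Weights d × GraphConfig d)) : Set (Extended d) :=
  {ω | (ω.1, ω.2.2) ∈ A}

/-- Cylinder events `{η(e₁) = a₁, …, η(e_n) = a_n}` of `Ω₃`. -/
def IsCylinder (V : Set (GraphConfig d)) : Prop :=
  ∃ L : Finset (DirEdge d × Bool), V = {η | ∀ c ∈ L, η c.1 = c.2}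

/-- Graph-cylinder events: finite unions of `U × V` with `U` Borel and `V` a cylinder event. -/
def IsGraphCylinder (A : Set (Weights d × GraphConfig d)) : Prop :=
  ∃ (m : ℕ) (U : Fin m → Set (Weights d)) (V : Fin m → Set (GraphConfig d)),
    (∀ i, MeasurableSet (U i)) ∧ (∀ i, IsCylinder (V i)) ∧ A = ⋃ i, U i ×ˢ V i

/-- `e₀`-approximable events for `μ`. -/
def IsApproximable (ρ : Fin d → ℝ) (μ : Measure (Extended d)) (e₀ : Edge d)
    (A : Set (Weights d × GraphConfig d)) : Prop :=
  MeasurableSet A ∧ ∃ A' : ℕ → Set (Weights d × GraphConfig d),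
    (∀ n, IsGraphCylinder (A' n)) ∧
    Tendsto (fun n => μ (liftEvent (symmDiff (A' n) A))) atTop (𝓝 0) ∧
    ∀ n, ∃ α₀ : ℝ, ∀ α ≥ α₀, ∀ t t' : Weights d,
      t e₀ ≤ t' e₀ → (∀ e, e ≠ e₀ → t' e = t e) →
      (t, geoGraph ρ α t) ∈ A' n → (t', geoGraph ρ α t') ∈ A' n

end FPP

end

namespace FPP

variable {d : ℕ}

/-! ### Joint measurability in the level of the hyperplane and the weights -/

/-! Write `E` for the event `l ≤ t e₀`. The heart is a bound `P D ≤ K * P (D ∩ E) + ε` for all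
events `D` that do not depend on `t e₀`, with `K` depending on `ε` but not on `D`
(`exists_measure_le_mul_add`). It comes from independence under A and from upward finite energy
under B.

If `B` increases in `t e₀`, resetting that weight to `l` turns `B` into an event `D` off `e₀` with
`B ⊆ D ∪ (B ∩ E)` and `D ∩ E ⊆ B ∩ E`, so `P B ≤ (K + 1) * P (B ∩ E) + ε`
(`measure_le_mul_add_of_increasing`). This applies to the preimage of an approximating
graph-cylinder event at every level `α ≥ α₀`; averaging over `α` in `[0, n]`, the levels below `α₀`
cost at most of order `1 / n`.

Weak convergence alone does not control Borel sets of weights. But all the averaged measures have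
weight marginal `P`, so approximating an indicator in `L¹(P)` by a continuous function has an error
uniform in `n`, and the masses of graph-cylinder events do converge
(`tendsto_measureReal_graphCylinder`). The inequality thus passes to `μ`, then to approximable
events (`IsApproximable.measureReal_le`); `ε = r / 2` finishes. -/

instance countable_dirEdge : Countable (DirEdge d) :=
  (SimpleGraph.Dart.toProd_injective (G := lattice d)).countable

instance countable_walk (x y : Vertex d) : Countable ((lattice d).Walk x y) :=
  (SimpleGraph.Walk.support_injective (G := lattice d) (u := x) (v := y)).countable

lemma measurable_pathTime {x y : Vertex d} (p : (lattice d).Walk x y) :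
    Measurable fun t : Weights d => pathTime t p := by
  unfold pathTime
  induction p.darts with
  | nil => simp
  | cons a l ih =>
    simp only [List.map_cons, List.sum_cons]
    exact (measurable_pi_apply _).add ih

lemma measurable_vertexTime (x y : Vertex d) :
    Measurable fun t : Weights d => vertexTime t x y :=
  Measurable.iInf fun p => measurable_pathTime p

/-- The levels `α` such that `v` is the integer part of a point of `H_ρ(α)`. -/
def levelSet (ρ : Fin d → ℝ) (v : Vertex d) : Set ℝ :=
  {α | ∃ z ∈ hyperplane ρ α, floorPt z = v}

/-- The points with integer part `v` form a convex cube, whose image under the linear form `z ↦ z ⬝ᵥ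
ρ` is order-connected. -/
lemma measurableSet_levelSet (ρ : Fin d → ℝ) (v : Vertex d) : MeasurableSet (levelSet ρ v) := by
  have hcube : Convex ℝ {z : Fin d → ℝ | floorPt z = v} := by
    have : {z : Fin d → ℝ | floorPt z = v}
        = Set.univ.pi fun i => Set.Ico (v i : ℝ) (v i + 1) := by
      ext z
      simp only [Set.mem_ofPred_eq, funext_iff, floorPt, Int.floor_eq_iff, Set.mem_pi,
        Set.mem_univ, true_imp_iff, Set.mem_Ico]
    rw [this]
    exact convex_pi fun i _ => convex_Ico _ _
  have himage : levelSet ρ v = (fun z => z ⬝ᵥ ρ) '' {z : Fin d → ℝ | floorPt z = v} := by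
    ext α
    simp only [levelSet, hyperplane, Set.mem_ofPred_eq, Set.mem_image]
    exact exists_congr fun z => and_comm
  have hlin : IsLinearMap ℝ fun z : Fin d → ℝ => z ⬝ᵥ ρ :=
    ⟨fun x y => add_dotProduct x y ρ, fun c x => smul_dotProduct c x ρ⟩
  rw [himage]
  exact (hcube.is_linear_image hlin).ordConnected.measurableSet

/-- Replaces the infimum over uncountably many points by a condition on countably many vertices,
which gives measurability. The second alternative is the empty hyperplane, where the infimum in
`ℝ≥0` is `0`. -/
lemma planeTime_lt_iff (t : Weights d) (ρ : Fin d → ℝ) (α : ℝ) (x : Vertex d) (c : ℝ≥0) :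
    planeTime t ρ α x < c ↔
      (∃ v, α ∈ levelSet ρ v ∧ vertexTime t x v < c) ∨ ((∀ v, α ∉ levelSet ρ v) ∧ 0 < c) := by
  unfold planeTime
  rcases isEmpty_or_nonempty (hyperplane ρ α) with h | h
  · have hnone : ∀ v, α ∉ levelSet ρ v := fun v ⟨z, hz, _⟩ => h.elim ⟨z, hz⟩
    simp [hnone, NNReal.iInf_empty]
  · have hsome : ¬ ∀ v, α ∉ levelSet ρ v := fun hv =>
      let z := h.some
      hv (floorPt z.1) ⟨z.1, z.2, rfl⟩
    rw [ciInf_lt_iff (OrderBot.bddBelow _)]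
    simp only [hsome, false_and, or_false, Subtype.exists]
    constructor
    · rintro ⟨z, hz, hlt⟩
      exact ⟨_, ⟨z, hz, rfl⟩, hlt⟩
    · rintro ⟨_, ⟨z, hz, rfl⟩, hlt⟩
      exact ⟨z, hz, hlt⟩

lemma measurable_planeTime (ρ : Fin d → ℝ) (x : Vertex d) :
    Measurable fun q : ℝ × Weights d => planeTime q.2 ρ q.1 x := by
  refine measurable_of_Iio fun c => ?_
  have hlevel : ∀ v, MeasurableSet {q : ℝ × Weights d | q.1 ∈ levelSet ρ v} := fun v =>
    measurable_fst (measurableSet_levelSet ρ v)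
  have hattained : MeasurableSet {q : ℝ × Weights d |
      ∃ v, q.1 ∈ levelSet ρ v ∧ vertexTime q.2 x v < c} := by
    simp only [Set.ofPred_exists]
    exact MeasurableSet.iUnion fun v => (hlevel v).inter <|
      ((measurable_vertexTime x v).comp measurable_snd) measurableSet_Iio
  have hempty : MeasurableSet {q : ℝ × Weights d | ∀ v, q.1 ∉ levelSet ρ v} := by
    simp only [Set.ofPred_forall]
    exact MeasurableSet.iInter fun v => (hlevel v).compl
  convert hattained.union (hempty.inter (MeasurableSet.const (0 < c))) using 1
  ext q
  exact planeTime_lt_iff q.2 ρ q.1 x c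

lemma measurable_geoGraph (ρ : Fin d → ℝ) :
    Measurable fun q : ℝ × Weights d => geoGraph ρ q.1 q.2 := by
  refine measurable_pi_lambda _ fun a => measurable_to_bool ?_
  simp only [Set.preimage, Set.mem_singleton_iff, geoGraph, decide_eq_true_eq, Set.ofPred_exists]
  refine MeasurableSet.iUnion fun v => MeasurableSet.iUnion fun p => ?_
  refine MeasurableSet.inter (MeasurableSet.inter ?_ ?_) (MeasurableSet.const _)
  · exact measurable_fst (measurableSet_levelSet ρ v)
  · exact measurableSet_eq_fun ((measurable_pathTime p).comp measurable_snd)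
      (measurable_planeTime ρ a.fst)

lemma measurable_Phi (ρ : Fin d → ℝ) :
    Measurable fun q : ℝ × Weights d => Phi ρ q.1 q.2 := by
  refine measurable_snd.prodMk (Measurable.prodMk ?_ (measurable_geoGraph ρ))
  refine measurable_pi_lambda _ fun xy => Measurable.sub ?_ ?_
  · exact (measurable_planeTime ρ xy.1).coe_nnreal_real
  · exact (measurable_planeTime ρ xy.2).coe_nnreal_real

lemma measurable_Phi_level (ρ : Fin d → ℝ) (α : ℝ) : Measurable (Phi (d := d) ρ α) :=
  (measurable_Phi ρ).comp measurable_prodMk_left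

lemma measurable_planeMeasure (P : Measure (Weights d)) [SFinite P] (ρ : Fin d → ℝ) :
    Measurable (planeMeasure P ρ) := by
  refine Measure.measurable_of_measurable_coe _ fun s hs => ?_
  simp only [planeMeasure, Measure.map_apply (measurable_Phi_level ρ _) hs]
  exact measurable_measure_prodMk_left (measurable_Phi ρ hs)

/-! ### The averaged measures -/

lemma averageMeasure_apply (P : Measure (Weights d)) [SFinite P] (ρ : Fin d → ℝ) (n : ℕ)
    {s : Set (Extended d)} (hs : MeasurableSet s) :
    averageMeasure P ρ n s =
      (n : ℝ≥0∞)⁻¹ * ∫⁻ α in Set.Icc (0 : ℝ) n, P (Phi ρ α ⁻¹' s) := by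
  rw [averageMeasure, Measure.smul_apply, smul_eq_mul,
    Measure.bind_apply hs (measurable_planeMeasure P ρ).aemeasurable]
  simp only [planeMeasure, Measure.map_apply (measurable_Phi_level ρ _) hs]

/-- `Phi` leaves the weights unchanged at every level, so averaging does not alter their law. -/
lemma map_fst_averageMeasure (P : Measure (Weights d)) [SFinite P] (ρ : Fin d → ℝ) {n : ℕ}
    (hn : n ≠ 0) : (averageMeasure P ρ n).map Prod.fst = P := by
  ext s hs
  rw [Measure.map_apply measurable_fst hs, averageMeasure_apply P ρ n (measurable_fst hs)]
  have : ∀ α, Phi ρ α ⁻¹' (Prod.fst ⁻¹' s) = s := fun α => rfl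
  simp only [this, lintegral_const, Measure.restrict_apply_univ, Real.volume_Icc, sub_zero,
    ENNReal.ofReal_natCast]
  rw [mul_comm (P s), ← mul_assoc,
    ENNReal.inv_mul_cancel (by exact_mod_cast hn) (ENNReal.natCast_ne_top n), one_mul]

lemma isProbabilityMeasure_averageMeasure (P : Measure (Weights d)) [IsProbabilityMeasure P]
    (ρ : Fin d → ℝ) {n : ℕ} (hn : n ≠ 0) : IsProbabilityMeasure (averageMeasure P ρ n) := by
  refine ⟨?_⟩
  have h := congrArg (fun ν => ν Set.univ) (map_fst_averageMeasure P ρ hn)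
  simpa [Measure.map_apply measurable_fst] using h

/-! ### Raising the weight of one edge -/

lemma sigmaOff_le (e₀ : Edge d) : sigmaOff e₀ ≤ (inferInstance : MeasurableSpace (Weights d)) :=
  measurable_iff_comap_le.mp (measurable_pi_lambda _ fun f => measurable_pi_apply f.1)

lemma measurableSet_le_weight (e₀ : Edge d) (l : ℝ≥0) :
    MeasurableSet {t : Weights d | l ≤ t e₀} :=
  measurable_pi_apply e₀ measurableSet_Ici

lemma measure_pos_of_lt_supSupport {P : Measure (Weights d)} {e₀ : Edge d} {l : ℝ≥0}
    (hl : (l : ℝ≥0∞) < supSupport P e₀) : 0 < P {t | l ≤ t e₀} := by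
  simp only [supSupport, lt_iSup_iff] at hl
  obtain ⟨x, hx, hlx⟩ := hl
  exact hx.trans_le (measure_mono fun t ht => (ENNReal.coe_lt_coe.mp hlx).le.trans ht)

lemma AssumptionA.measure_inter_eq_mul {P : Measure (Weights d)} (hP : AssumptionA P)
    (e₀ : Edge d) (l : ℝ≥0) {D : Set (Weights d)} (hD : MeasurableSet[sigmaOff e₀] D) :
    P (D ∩ {t | l ≤ t e₀}) = P D * P {t | l ≤ t e₀} := by
  have hindep := indep_iSup_of_disjoint
    (m := fun e : Edge d => MeasurableSpace.comap (fun t : Weights d => t e) inferInstance)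
    (fun e => measurable_iff_comap_le.mp (measurable_pi_apply e)) hP.indep.iIndep
    (S := {e₀}ᶜ) (T := {e₀}) disjoint_compl_left
  rw [Indep_iff] at hindep
  refine hindep D _ ?_ ?_
  · refine (measurable_iff_comap_le.mp ?_ : sigmaOff e₀ ≤ _) D hD
    refine @measurable_pi_lambda _ _ _ (_) _ _ fun f => ?_
    exact measurable_iff_comap_le.mpr
      (le_iSup₂_of_le (f := fun (e : Edge d) (_ : e ∈ ({e₀}ᶜ : Set (Edge d))) =>
        MeasurableSpace.comap (fun t : Weights d => t e) inferInstance) f.1 f.2 le_rfl)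
  · rw [iSup_singleton]
    exact ⟨Set.Ici l, measurableSet_Ici, rfl⟩

/-- An almost surely positive conditional probability is at least some `1 / (n + 1)` outside an
`m`-measurable set of mass below `ε`. Integrating it over the rest of `D` gives the bound with `K =
n + 1`. -/
lemma exists_measure_le_mul_add_of_condExp_pos {Ω : Type*} {m m₀ : MeasurableSpace Ω}
    (hm : m ≤ m₀) (P : Measure[m₀] Ω) [IsProbabilityMeasure P] {E : Set Ω}
    (hE : MeasurableSet[m₀] E) (hpos : ∀ᵐ ω ∂P, 0 < (P⟦E | m⟧) ω) {ε : ℝ≥0∞} (hε : ε ≠ 0) :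
    ∃ K : ℝ≥0, ∀ D, MeasurableSet[m] D → P D ≤ K * P (D ∩ E) + ε := by
  set X : Ω → ℝ := P⟦E | m⟧ with hX
  have hXm : Measurable[m] X := stronglyMeasurable_condExp.measurable
  have hXint : Integrable X P := integrable_condExp
  let low : ℕ → Set Ω := fun n => {ω | X ω < 1 / ((n : ℝ) + 1)}
  have hlow : ∀ n, MeasurableSet[m] (low n) := fun n => hXm measurableSet_Iio
  have hanti : Antitone low := fun i j hij ω (hω : X ω < _) =>
    show X ω < _ from hω.trans_le (Nat.one_div_le_one_div hij)
  have hnull : P (⋂ n, low n) = 0 := by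
    refine measure_mono_null (fun ω hω => ?_) (ae_iff.mp hpos)
    intro hlt
    obtain ⟨n, hn⟩ := exists_nat_one_div_lt hlt
    exact lt_asymm hn (Set.mem_iInter.mp hω n)
  have hlim : Tendsto (fun n => P (low n)) atTop (𝓝 0) := by
    rw [← hnull]
    exact tendsto_measure_iInter_atTop (fun n => (hm _ (hlow n)).nullMeasurableSet) hanti
      ⟨0, measure_ne_top _ _⟩
  obtain ⟨n, hn⟩ := (hlim.eventually_lt_const (pos_iff_ne_zero.mpr hε)).exists
  refine ⟨n + 1, fun D hD => ?_⟩
  have hD' : MeasurableSet[m] (D \ low n) := hD.diff (hlow n)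
  have hmass : P.real (D \ low n) ≤ ((n : ℝ) + 1) * P.real (D ∩ E) := by
    -- The defining property of conditional expectation applies because `low n` is itself
    -- `m`-measurable.
    have hset : ∫ ω in D \ low n, X ω ∂P = P.real ((D \ low n) ∩ E) := by
      rw [hX, setIntegral_condExp hm ((integrable_const (1 : ℝ)).indicator hE) hD',
        integral_indicator_const _ hE, measureReal_restrict_apply hE, smul_eq_mul, mul_one,
        Set.inter_comm]
    have hge : 1 / ((n : ℝ) + 1) * P.real (D \ low n) ≤ ∫ ω in D \ low n, X ω ∂P :=
      setIntegral_ge_of_const_le_real (hm _ hD') (measure_ne_top _ _)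
        (fun ω hω => not_lt.mp hω.2) hXint.integrableOn
    have hmono : P.real ((D \ low n) ∩ E) ≤ P.real (D ∩ E) :=
      measureReal_mono (Set.inter_subset_inter_left _ Set.sdiff_subset)
    rw [hset] at hge
    have hn0 : (0 : ℝ) < (n : ℝ) + 1 := by positivity
    rw [one_div, inv_mul_le_iff₀ hn0] at hge
    exact hge.trans (mul_le_mul_of_nonneg_left hmono hn0.le)
  have hmass' : P (D \ low n) ≤ ((n + 1 : ℝ≥0) : ℝ≥0∞) * P (D ∩ E) := by
    rw [← ENNReal.toReal_le_toReal (measure_ne_top _ _)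
      (ENNReal.mul_ne_top ENNReal.coe_ne_top (measure_ne_top _ _)), ENNReal.toReal_mul]
    exact hmass
  calc P D ≤ P (D \ low n) + P (low n) := by
        refine (measure_mono ?_).trans (measure_union_le _ _)
        rw [Set.sdiff_union_self]
        exact Set.subset_union_left
    _ ≤ _ := add_le_add hmass' hn.le

lemma exists_measure_le_mul_add {P : Measure (Weights d)} [IsProbabilityMeasure P]
    (hP : AssumptionA P ∨ AssumptionB P) {e₀ : Edge d} {l : ℝ≥0}
    (hl : (l : ℝ≥0∞) < supSupport P e₀) {ε : ℝ≥0∞} (hε : ε ≠ 0) :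
    ∃ K : ℝ≥0, ∀ D, MeasurableSet[sigmaOff e₀] D →
      P D ≤ K * P (D ∩ {t | l ≤ t e₀}) + ε := by
  have hpos := measure_pos_of_lt_supSupport hl
  rcases hP with hA | hB
  · refine ⟨(P {t | l ≤ t e₀})⁻¹.toNNReal, fun D hD => ?_⟩
    rw [hA.measure_inter_eq_mul e₀ l hD, ENNReal.coe_toNNReal (ENNReal.inv_ne_top.mpr hpos.ne'),
      mul_comm (P D), ← mul_assoc, ENNReal.inv_mul_cancel hpos.ne' (measure_ne_top _ _), one_mul]
    exact le_self_add
  -- Finite energy is assumed for positive thresholds only; at `l = 0` the event is the whole space.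
  · rcases eq_zero_or_pos l with rfl | hl0
    · refine ⟨1, fun D _ => ?_⟩
      simp
    · exact exists_measure_le_mul_add_of_condExp_pos (sigmaOff_le e₀) P
        (measurableSet_le_weight e₀ l) (hB.finite_energy e₀ l hl0 hpos) hε

open Classical in
-- The updated configuration is a measurable function `glue` of the weights off `e₀`.
lemma measurableSet_sigmaOff_update (e₀ : Edge d) (l : ℝ≥0) {B : Set (Weights d)}
    (hB : MeasurableSet B) :
    MeasurableSet[sigmaOff e₀] {t : Weights d | Function.update t e₀ l ∈ B} := by
  let glue : ({f : Edge d // f ≠ e₀} → ℝ≥0) → Weights d :=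
    fun u e => if h : e = e₀ then l else u ⟨e, h⟩
  have hglue : Measurable glue := by
    refine measurable_pi_lambda _ fun e => ?_
    by_cases h : e = e₀
    · simp only [glue, h, dite_true]
      exact measurable_const
    · simp only [glue, h, dite_false]
      exact measurable_pi_apply _
  refine ⟨glue ⁻¹' B, hglue hB, ?_⟩
  ext t
  have : glue (fun f => t f.1) = Function.update t e₀ l := by
    ext e
    by_cases h : e = e₀ <;> simp [glue, h]
  simp [this]

open Classical in
/-- An event that is increasing in `t_{e₀}` meets `{l ≤ t_{e₀}}` with a probability controlled from
below, provided that every event off `e₀` does. -/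
lemma measure_le_mul_add_of_increasing {P : Measure (Weights d)} {e₀ : Edge d} {l : ℝ≥0}
    {K : ℝ≥0} {ε : ℝ≥0∞}
    (hK : ∀ D, MeasurableSet[sigmaOff e₀] D → P D ≤ K * P (D ∩ {t | l ≤ t e₀}) + ε)
    {B : Set (Weights d)} (hB : MeasurableSet B)
    (hinc : ∀ t t' : Weights d, t e₀ ≤ t' e₀ → (∀ e, e ≠ e₀ → t' e = t e) → t ∈ B → t' ∈ B) :
    P B ≤ (K + 1) * P (B ∩ {t | l ≤ t e₀}) + ε := by
  let D : Set (Weights d) := {t | Function.update t e₀ l ∈ B}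
  have hsub : B ⊆ D ∪ (B ∩ {t | l ≤ t e₀}) := by
    intro t ht
    -- If `t e₀ ≤ l`, resetting to `l` raises the weight and stays in `B`. For `hD` below, going
    -- from `l` back to `t e₀ ≥ l` is again a raise.
    rcases le_total l (t e₀) with h | h
    · exact Or.inr ⟨ht, h⟩
    · exact Or.inl (hinc t _ (by simpa using h)
        (fun e he => Function.update_of_ne he _ _) ht)
  have hD : D ∩ {t | l ≤ t e₀} ⊆ B ∩ {t | l ≤ t e₀} := fun t ht =>
    ⟨hinc _ t (by simpa using ht.2) (fun e he => (Function.update_of_ne he _ _).symm) ht.1, ht.2⟩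
  calc P B ≤ P D + P (B ∩ {t | l ≤ t e₀}) := (measure_mono hsub).trans (measure_union_le _ _)
    _ ≤ (K * P (B ∩ {t | l ≤ t e₀}) + ε) + P (B ∩ {t | l ≤ t e₀}) := by
        gcongr
        exact (hK D (measurableSet_sigmaOff_update e₀ l hB)).trans (by gcongr)
    _ = _ := by ring

/-! ### Convergence of the averaged measures on graph-cylinder events -/

lemma IsGeodesicMeasure.map_fst {P : Measure (Weights d)} [IsProbabilityMeasure P]
    {ρ : Fin d → ℝ} {μ : Measure (Extended d)} (hμ : IsGeodesicMeasure P ρ μ) :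
    μ.map Prod.fst = P := by
  have := hμ.isProb
  have : IsProbabilityMeasure (μ.map Prod.fst) :=
    Measure.isProbabilityMeasure_map measurable_fst.aemeasurable
  obtain ⟨n, hn, hlim⟩ := hμ.limit
  refine ext_of_forall_integral_eq_of_IsFiniteMeasure fun f => ?_
  rw [integral_map measurable_fst.aemeasurable f.continuous.measurable.aestronglyMeasurable]
  refine tendsto_nhds_unique
    (hlim (f.compContinuous ⟨Prod.fst, continuous_fst⟩)) (tendsto_const_nhds.congr' ?_)
  filter_upwards [hn.tendsto_atTop.eventually_ne_atTop 0] with k hk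
  conv_lhs => rw [← map_fst_averageMeasure P ρ hk]
  rw [integral_map measurable_fst.aemeasurable f.continuous.measurable.aestronglyMeasurable]
  rfl

/-- Allows the convergence of masses to be used on both sides of the inequality. -/
lemma isGraphCylinder_inter_weight {C : Set (Weights d × GraphConfig d)} (hC : IsGraphCylinder C)
    (e₀ : Edge d) (l : ℝ≥0) : IsGraphCylinder (C ∩ {q | l ≤ q.1 e₀}) := by
  obtain ⟨m, U, V, hU, hV, rfl⟩ := hC
  refine ⟨m, fun i => U i ∩ {t | l ≤ t e₀}, V,
    fun i => (hU i).inter (measurableSet_le_weight e₀ l), hV, ?_⟩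
  ext q
  simp only [Set.mem_inter_iff, Set.mem_iUnion, Set.mem_prod, Set.mem_ofPred_eq]
  constructor
  · rintro ⟨⟨i, h⟩, hl⟩
    exact ⟨i, ⟨h.1, hl⟩, h.2⟩
  · rintro ⟨i, h, hv⟩
    exact ⟨⟨i, h.1, hv⟩, h.2⟩

lemma IsCylinder.isClopen {V : Set (GraphConfig d)} (hV : IsCylinder V) : IsClopen V := by
  obtain ⟨L, rfl⟩ := hV
  have : {η : GraphConfig d | ∀ c ∈ L, η c.1 = c.2} = ⋂ c ∈ L, {η | η c.1 = c.2} := by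
    ext η
    simp
  rw [this]
  exact isClopen_biInter_finset fun c _ =>
    (isClopen_discrete {c.2}).preimage (continuous_apply c.1)

lemma measurable_forget : Measurable fun ω : Extended d => (ω.1, ω.2.2) :=
  measurable_fst.prodMk (measurable_snd.comp measurable_snd)

lemma measurableSet_liftEvent {A : Set (Weights d × GraphConfig d)} (hA : MeasurableSet A) :
    MeasurableSet (liftEvent A) :=
  measurable_forget hA

lemma IsGraphCylinder.measurableSet {C : Set (Weights d × GraphConfig d)}
    (hC : IsGraphCylinder C) : MeasurableSet C := by
  obtain ⟨m, U, V, hU, hV, rfl⟩ := hC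
  exact MeasurableSet.iUnion fun i => (hU i).prod (hV i).isClopen.isOpen.measurableSet

/-- The continuous observable `g(t) 1_V(η)` on the extended space. -/
noncomputable def weightedCylinder (g : Weights d →ᵇ ℝ) (V : Set (GraphConfig d)) (hV : IsClopen V) :
    Extended d →ᵇ ℝ :=
  g.compContinuous ⟨Prod.fst, continuous_fst⟩ *
    (BoundedContinuousFunction.indicator V hV).compContinuous
      ⟨fun ω => ω.2.2, continuous_snd.comp continuous_snd⟩

/-- The point is that the bound depends on `ν` only through its weight marginal, so it serves all
averaged measures and `μ` at once. -/
lemma abs_measureReal_prod_sub_integral_le {P : Measure (Weights d)} {ν : Measure (Extended d)}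
    [IsProbabilityMeasure ν] (hν : ν.map Prod.fst = P) {U : Set (Weights d)}
    (hU : MeasurableSet U) {V : Set (GraphConfig d)} (hV : IsClopen V) (g : Weights d →ᵇ ℝ) :
    |ν.real (liftEvent (U ×ˢ V)) - ∫ ω, weightedCylinder g V hV ω ∂ν| ≤
      ∫ t, ‖U.indicator (fun _ => (1 : ℝ)) t - g t‖ ∂P := by
  have hS : MeasurableSet (liftEvent (U ×ˢ V)) :=
    measurableSet_liftEvent (hU.prod hV.isOpen.measurableSet)
  have hUm : Measurable fun t => U.indicator (fun _ => (1 : ℝ)) t :=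
    measurable_const.indicator hU
  have hgm : Measurable g := g.continuous.measurable
  have hdiff : Measurable fun t => ‖U.indicator (fun _ => (1 : ℝ)) t - g t‖ := (hUm.sub hgm).norm
  have hdiff_int : Integrable (fun ω : Extended d =>
      ‖U.indicator (fun _ => (1 : ℝ)) ω.1 - g ω.1‖) ν := by
    refine Integrable.of_bound (hdiff.comp measurable_fst).aestronglyMeasurable (1 + ‖g‖)
      (Eventually.of_forall fun ω => ?_)
    rw [norm_norm]
    refine (norm_sub_le _ _).trans (add_le_add ?_ (g.norm_coe_le_norm _))
    refine (norm_indicator_le_norm_self _ _).trans (by simp)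
  rw [← hν, integral_map measurable_fst.aemeasurable hdiff.aestronglyMeasurable,
    ← integral_indicator_one hS,
    ← integral_sub (f := (liftEvent (U ×ˢ V)).indicator 1)
      ((integrable_const (1 : ℝ)).indicator hS)
      ((weightedCylinder g V hV).integrable ν), ← Real.norm_eq_abs]
  refine norm_integral_le_of_norm_le hdiff_int (Eventually.of_forall fun ω => ?_)
  by_cases hω : ω.2.2 ∈ V
  · by_cases hωU : ω.1 ∈ U <;> simp [weightedCylinder, liftEvent, hω, hωU]
  · simp [weightedCylinder, liftEvent, hω]

/-- Along a weakly convergent sequence of averaged measures, the mass of a product of a Borel set of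
weights with a clopen set of graphs converges: all the marginals on the weights are `P`. -/
lemma tendsto_measureReal_prod {P : Measure (Weights d)} [IsProbabilityMeasure P]
    {ρ : Fin d → ℝ} {μ : Measure (Extended d)} (hμ : IsGeodesicMeasure P ρ μ) {n : ℕ → ℕ}
    (hn : StrictMono n)
    (hlim : ∀ f : Extended d →ᵇ ℝ,
      Tendsto (fun k => ∫ ω, f ω ∂(averageMeasure P ρ (n k))) atTop (𝓝 (∫ ω, f ω ∂μ)))
    {U : Set (Weights d)} (hU : MeasurableSet U) {V : Set (GraphConfig d)} (hV : IsClopen V) :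
    Tendsto (fun k => (averageMeasure P ρ (n k)).real (liftEvent (U ×ˢ V))) atTop
      (𝓝 (μ.real (liftEvent (U ×ˢ V)))) := by
  have := hμ.isProb
  rw [Metric.tendsto_nhds]
  intro ε hε
  obtain ⟨g, hg, -⟩ := ((integrable_const (μ := P) (1 : ℝ)).indicator
    hU).exists_boundedContinuous_integral_sub_le (show 0 < ε / 3 by positivity)
  have hμg := (abs_measureReal_prod_sub_integral_le hμ.map_fst hU hV g).trans hg
  filter_upwards [Metric.tendsto_nhds.mp (hlim (weightedCylinder g V hV)) (ε / 3) (by positivity),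
    hn.tendsto_atTop.eventually_ne_atTop 0] with k hk hk0
  have := isProbabilityMeasure_averageMeasure P ρ hk0
  have hνg := (abs_measureReal_prod_sub_integral_le (map_fst_averageMeasure P ρ hk0) hU hV g).trans
    hg
  rw [Real.dist_eq, abs_lt] at hk ⊢
  rw [abs_le] at hμg hνg
  constructor <;> linarith [hk.1, hk.2, hμg.1, hμg.2, hνg.1, hνg.2]

lemma tendsto_measureReal_iUnion_prod {P : Measure (Weights d)} [IsProbabilityMeasure P]
    {ρ : Fin d → ℝ} {μ : Measure (Extended d)} (hμ : IsGeodesicMeasure P ρ μ) {n : ℕ → ℕ}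
    (hn : StrictMono n)
    (hlim : ∀ f : Extended d →ᵇ ℝ,
      Tendsto (fun k => ∫ ω, f ω ∂(averageMeasure P ρ (n k))) atTop (𝓝 (∫ ω, f ω ∂μ)))
    {ι : Type*} (s : Finset ι) (U : ι → Set (Weights d)) (V : ι → Set (GraphConfig d))
    (hU : ∀ i, MeasurableSet (U i)) (hV : ∀ i, IsClopen (V i)) :
    Tendsto (fun k => (averageMeasure P ρ (n k)).real (liftEvent (⋃ i ∈ s, U i ×ˢ V i))) atTop
      (𝓝 (μ.real (liftEvent (⋃ i ∈ s, U i ×ˢ V i)))) := by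
  classical
  have := hμ.isProb
  -- Inclusion–exclusion: the overlap with the new product is again a union of products over `s`,
  -- with different factors, hence the generalization.
  induction s using Finset.induction_on generalizing U V with
  | empty => simp [liftEvent]
  | insert a s _ ih =>
    have hmeas : MeasurableSet (liftEvent (⋃ i ∈ s, U i ×ˢ V i)) :=
      measurableSet_liftEvent <| Finset.measurableSet_biUnion s fun i _ =>
        (hU i).prod (hV i).isOpen.measurableSet
    have hunion : liftEvent (⋃ i ∈ insert a s, U i ×ˢ V i)
        = liftEvent (U a ×ˢ V a) ∪ liftEvent (⋃ i ∈ s, U i ×ˢ V i) := by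
      rw [Finset.set_biUnion_insert]
      rfl
    have hinter : liftEvent (⋃ i ∈ s, (U a ∩ U i) ×ˢ (V a ∩ V i))
        = liftEvent (U a ×ˢ V a) ∩ liftEvent (⋃ i ∈ s, U i ×ˢ V i) := by
      simp only [← Set.prod_inter_prod, ← Set.inter_iUnion]
      rfl
    have hincl : ∀ ν : Measure (Extended d), IsProbabilityMeasure ν →
        ν.real (liftEvent (⋃ i ∈ insert a s, U i ×ˢ V i))
          = ν.real (liftEvent (U a ×ˢ V a)) + ν.real (liftEvent (⋃ i ∈ s, U i ×ˢ V i))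
            - ν.real (liftEvent (⋃ i ∈ s, (U a ∩ U i) ×ˢ (V a ∩ V i))) := by
      intro ν hν
      rw [hunion, hinter, ← measureReal_union_add_inter hmeas, add_sub_cancel_right]
    rw [hincl μ this]
    refine Tendsto.congr' ?_ (((tendsto_measureReal_prod hμ hn hlim (hU a) (hV a)).add
      (ih U V hU hV)).sub (ih (fun i => U a ∩ U i) (fun i => V a ∩ V i)
        (fun i => (hU a).inter (hU i)) fun i => (hV a).inter (hV i)))
    filter_upwards [hn.tendsto_atTop.eventually_ne_atTop 0] with k hk0
    exact (hincl _ (isProbabilityMeasure_averageMeasure P ρ hk0)).symm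

lemma tendsto_measureReal_graphCylinder {P : Measure (Weights d)} [IsProbabilityMeasure P]
    {ρ : Fin d → ℝ} {μ : Measure (Extended d)} (hμ : IsGeodesicMeasure P ρ μ) {n : ℕ → ℕ}
    (hn : StrictMono n)
    (hlim : ∀ f : Extended d →ᵇ ℝ,
      Tendsto (fun k => ∫ ω, f ω ∂(averageMeasure P ρ (n k))) atTop (𝓝 (∫ ω, f ω ∂μ)))
    {C : Set (Weights d × GraphConfig d)} (hC : IsGraphCylinder C) :
    Tendsto (fun k => (averageMeasure P ρ (n k)).real (liftEvent C)) atTop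
      (𝓝 (μ.real (liftEvent C))) := by
  obtain ⟨m, U, V, hU, hV, rfl⟩ := hC
  simpa using tendsto_measureReal_iUnion_prod hμ hn hlim Finset.univ U V hU
    fun i => (hV i).isClopen

/-! ### From finite levels to the limit -/

lemma averageMeasure_le_of_level_le {P : Measure (Weights d)} [IsProbabilityMeasure P]
    {ρ : Fin d → ℝ} {S E : Set (Extended d)} (hS : MeasurableSet S) (hE : MeasurableSet E)
    {K ε : ℝ≥0} {α₀ : ℝ}
    (h : ∀ α ≥ α₀, P (Phi ρ α ⁻¹' S) ≤ K * P (Phi ρ α ⁻¹' (S ∩ E)) + ε) {n : ℕ} (hn : n ≠ 0) :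
    averageMeasure P ρ n S ≤
      K * averageMeasure P ρ n (S ∩ E) + ε + (n : ℝ≥0∞)⁻¹ * ENNReal.ofReal α₀ := by
  have hn0 : (n : ℝ≥0∞) ≠ 0 := by exact_mod_cast hn
  rw [averageMeasure_apply P ρ n hS, averageMeasure_apply P ρ n (hS.inter hE)]
  have hmeas : Measurable fun α => P (Phi ρ α ⁻¹' (S ∩ E)) :=
    measurable_measure_prodMk_left (measurable_Phi ρ (hS.inter hE))
  -- Below `α₀` nothing is known, so the probability is bounded by `1`.
  have hpoint : ∀ α, P (Phi ρ α ⁻¹' S) ≤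
      K * P (Phi ρ α ⁻¹' (S ∩ E)) + ε + (Set.Iio α₀).indicator (fun _ => 1) α := by
    intro α
    by_cases hα : α < α₀
    · rw [Set.indicator_of_mem (Set.mem_Iio.mpr hα)]
      exact prob_le_one.trans le_add_self
    · exact (h α (not_lt.mp hα)).trans le_self_add
  have hearly : ∫⁻ α in Set.Icc (0 : ℝ) n, (Set.Iio α₀).indicator (fun _ => (1 : ℝ≥0∞)) α
      ≤ ENNReal.ofReal α₀ := by
    rw [lintegral_indicator measurableSet_Iio, lintegral_const, one_mul,
      Measure.restrict_apply_univ, Measure.restrict_apply measurableSet_Iio]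
    calc volume (Set.Iio α₀ ∩ Set.Icc (0 : ℝ) n) ≤ volume (Set.Ico 0 α₀) :=
          measure_mono fun α hα => ⟨hα.2.1, hα.1⟩
      _ = ENNReal.ofReal α₀ := by rw [Real.volume_Ico, sub_zero]
  have hint : ∫⁻ α in Set.Icc (0 : ℝ) n, P (Phi ρ α ⁻¹' S) ≤
      K * (∫⁻ α in Set.Icc (0 : ℝ) n, P (Phi ρ α ⁻¹' (S ∩ E))) + ε * n + ENNReal.ofReal α₀ := by
    refine (lintegral_mono hpoint).trans ?_
    rw [lintegral_add_left ((hmeas.const_mul _).add_const _),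
      lintegral_add_left (hmeas.const_mul _), lintegral_const_mul _ hmeas, lintegral_const,
      Measure.restrict_apply_univ, Real.volume_Icc, sub_zero, ENNReal.ofReal_natCast]
    gcongr
  calc _ ≤ (n : ℝ≥0∞)⁻¹ * (K * (∫⁻ α in Set.Icc (0 : ℝ) n, P (Phi ρ α ⁻¹' (S ∩ E)))
          + ε * n + ENNReal.ofReal α₀) := by gcongr
    _ = K * ((n : ℝ≥0∞)⁻¹ * ∫⁻ α in Set.Icc (0 : ℝ) n, P (Phi ρ α ⁻¹' (S ∩ E)))
          + ε * ((n : ℝ≥0∞)⁻¹ * n) + (n : ℝ≥0∞)⁻¹ * ENNReal.ofReal α₀ := by ring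
    _ = _ := by rw [ENNReal.inv_mul_cancel hn0 (ENNReal.natCast_ne_top n), mul_one]

lemma measureReal_graphCylinder_le {P : Measure (Weights d)} [IsProbabilityMeasure P]
    {ρ : Fin d → ℝ} {μ : Measure (Extended d)} (hμ : IsGeodesicMeasure P ρ μ)
    {e₀ : Edge d} {l : ℝ≥0} {K ε : ℝ≥0}
    (hK : ∀ D, MeasurableSet[sigmaOff e₀] D → P D ≤ K * P (D ∩ {t | l ≤ t e₀}) + ε)
    {C : Set (Weights d × GraphConfig d)} (hC : IsGraphCylinder C) {α₀ : ℝ}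
    (hinc : ∀ α ≥ α₀, ∀ t t' : Weights d, t e₀ ≤ t' e₀ → (∀ e, e ≠ e₀ → t' e = t e) →
      (t, geoGraph ρ α t) ∈ C → (t', geoGraph ρ α t') ∈ C) :
    μ.real (liftEvent C) ≤ (K + 1) * μ.real (liftEvent C ∩ {ω | l ≤ ω.1 e₀}) + ε := by
  obtain ⟨n, hn, hlim⟩ := hμ.limit
  have hE : MeasurableSet {ω : Extended d | l ≤ ω.1 e₀} :=
    measurable_fst (measurableSet_le_weight e₀ l)
  have hS := measurableSet_liftEvent hC.measurableSet
  have hlevel : ∀ α ≥ α₀, P (Phi ρ α ⁻¹' liftEvent C) ≤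
      ((K + 1 : ℝ≥0) : ℝ≥0∞) * P (Phi ρ α ⁻¹' (liftEvent C ∩ {ω | l ≤ ω.1 e₀})) + ε := by
    intro α hα
    rw [ENNReal.coe_add, ENNReal.coe_one]
    exact measure_le_mul_add_of_increasing hK (measurable_Phi_level ρ α hS) (hinc α hα)
  have hzero : Tendsto (fun k => ((n k : ℝ))⁻¹ * (ENNReal.ofReal α₀).toReal) atTop (𝓝 0) := by
    simpa using ((tendsto_inv_atTop_nhds_zero_nat (𝕜 := ℝ)).comp hn.tendsto_atTop).mul_const
      (ENNReal.ofReal α₀).toReal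
  have hright := (((tendsto_measureReal_graphCylinder hμ hn hlim
    (isGraphCylinder_inter_weight hC e₀ l)).const_mul ((K : ℝ) + 1)).add_const (ε : ℝ)).add hzero
  rw [add_zero] at hright
  refine le_of_tendsto_of_tendsto (tendsto_measureReal_graphCylinder hμ hn hlim hC) hright ?_
  filter_upwards [hn.tendsto_atTop.eventually_ne_atTop 0] with k hk0
  have := isProbabilityMeasure_averageMeasure P ρ hk0
  have hle := averageMeasure_le_of_level_le hS hE hlevel hk0
  have hfin : ((K + 1 : ℝ≥0) : ℝ≥0∞) *
      averageMeasure P ρ (n k) (liftEvent C ∩ {ω | l ≤ ω.1 e₀}) ≠ ∞ :=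
    ENNReal.mul_ne_top ENNReal.coe_ne_top (measure_ne_top _ _)
  have hfin' : ((n k : ℝ≥0∞))⁻¹ * ENNReal.ofReal α₀ ≠ ∞ :=
    ENNReal.mul_ne_top (ENNReal.inv_ne_top.mpr (by exact_mod_cast hk0)) ENNReal.ofReal_ne_top
  have hreal := ENNReal.toReal_mono
    (ENNReal.add_ne_top.mpr ⟨ENNReal.add_ne_top.mpr ⟨hfin, ENNReal.coe_ne_top⟩, hfin'⟩) hle
  rw [ENNReal.toReal_add (ENNReal.add_ne_top.mpr ⟨hfin, ENNReal.coe_ne_top⟩) hfin',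
    ENNReal.toReal_add hfin ENNReal.coe_ne_top, ENNReal.toReal_mul, ENNReal.toReal_mul,
    ENNReal.toReal_inv, ENNReal.toReal_natCast] at hreal
  exact hreal

/-- Replacing `A` by `C n` costs the mass of the symmetric difference once on the left and `K + 1`
times on the right; both vanish since `K` does not depend on `n`. -/
lemma IsApproximable.measureReal_le {P : Measure (Weights d)} [IsProbabilityMeasure P]
    {ρ : Fin d → ℝ} {μ : Measure (Extended d)} (hμ : IsGeodesicMeasure P ρ μ)
    {e₀ : Edge d} {l : ℝ≥0} {K ε : ℝ≥0}
    (hK : ∀ D, MeasurableSet[sigmaOff e₀] D → P D ≤ K * P (D ∩ {t | l ≤ t e₀}) + ε)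
    {A : Set (Weights d × GraphConfig d)} (hA : IsApproximable ρ μ e₀ A) :
    μ.real (liftEvent A) ≤ (K + 1) * μ.real (liftEvent A ∩ {ω | l ≤ ω.1 e₀}) + ε := by
  have := hμ.isProb
  obtain ⟨-, C, hC, hlim, hinc⟩ := hA
  have hlim' : Tendsto (fun n => μ.real (liftEvent (symmDiff (C n) A))) atTop (𝓝 0) := by
    exact (ENNReal.tendsto_toReal ENNReal.zero_ne_top).comp hlim
  have hright := (hlim'.const_mul ((K : ℝ) + 1 + 1)).const_add
    (((K : ℝ) + 1) * μ.real (liftEvent A ∩ {ω | l ≤ ω.1 e₀}) + ε)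
  rw [mul_zero, add_zero] at hright
  refine ge_of_tendsto' hright fun n => ?_
  obtain ⟨α₀, hα₀⟩ := hinc n
  have hcyl := measureReal_graphCylinder_le hμ hK (hC n) hα₀
  have hAC : μ.real (liftEvent A) ≤
      μ.real (liftEvent (C n)) + μ.real (liftEvent (symmDiff (C n) A)) := by
    refine (measureReal_mono fun ω hω => ?_).trans (measureReal_union_le _ _)
    by_cases h : ω ∈ liftEvent (C n)
    · exact Or.inl h
    · exact Or.inr (Or.inr ⟨hω, h⟩)
  have hCA : μ.real (liftEvent (C n) ∩ {ω | l ≤ ω.1 e₀}) ≤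
      μ.real (liftEvent A ∩ {ω | l ≤ ω.1 e₀}) + μ.real (liftEvent (symmDiff (C n) A)) := by
    refine (measureReal_mono fun ω hω => ?_).trans (measureReal_union_le _ _)
    by_cases h : ω ∈ liftEvent A
    · exact Or.inl ⟨h, hω.2⟩
    · exact Or.inr (Or.inl ⟨hω.1, h⟩)
  have hmul := mul_le_mul_of_nonneg_left hCA (by positivity : (0 : ℝ) ≤ (K : ℝ) + 1)
  linarith

end FPP

theorem theoremA1 (d : ℕ) (hd : 2 ≤ d)
    (P : Measure (FPP.Weights d)) [IsProbabilityMeasure P]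
    (hP : FPP.AssumptionA P ∨ FPP.AssumptionB P)
    (ρ : Fin d → ℝ) (hρ : FPP.IsSupporting P ρ)
    (μ : Measure (FPP.Extended d)) (hμ : FPP.IsGeodesicMeasure P ρ μ)
    (e₀ : FPP.Edge d) (l : ℝ≥0) (hl : (l : ℝ≥0∞) < FPP.supSupport P e₀)
    (r : ℝ) (hr : 0 < r) :
    ∃ s : ℝ, 0 < s ∧ ∀ A : Set (FPP.Weights d × FPP.GraphConfig d),
      FPP.IsApproximable ρ μ e₀ A → r ≤ μ.real (FPP.liftEvent A) →
        s ≤ μ.real (FPP.liftEvent A ∩ {ω | l ≤ ω.1 e₀}) := by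
  -- With error `r / 2`, at least half of the mass `r` must come from the term with `K + 1`. Both
  -- constants are fixed before `A`, so `s` is uniform.
  have hε : ((r / 2).toNNReal : ℝ≥0∞) ≠ 0 := by
    simpa using hr
  obtain ⟨K, hK⟩ := FPP.exists_measure_le_mul_add hP hl hε
  have hK0 : (0 : ℝ) < (K : ℝ) + 1 := by positivity
  refine ⟨r / 2 / (K + 1), by positivity, fun A hA hrA => ?_⟩
  have h := hA.measureReal_le hμ hK
  rw [Real.coe_toNNReal _ (by positivity)] at h
  rw [div_le_iff₀' hK0]
  linarith
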